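/- Let $\varphi : M\times\mathbb{R}\to M$, $(x,t)\mapsto xt$, be a continuous flow on a locally compact ANR $M$ (a metrizable space which, whenever embedded as a closed subset of a metrizable space, is a retract of a neighborhood of itself there), and let $K\subset M$ be an isolated non-saddle set. That is, $K$ is a compact invariant set which is the maximal invariant subset of some compact neighborhood of itself (an isolating neighborhood), and for every neighborhood $U$ of $K$ there is a neighborhood $V$ of $K$ such that each $x\in V$ satisfies $x[0,\infty)\subset U$ or $x(-\infty,0]\subset U$. Let $\mathcal{A}(K)$ (resp. $\mathcal{R}(K)$) be the set of points $x$ whose $\omega$-limit $\omega(x)$ (resp. negative $\omega$-limit $\omega^*(x)$) is non-empty and contained in $K$, and let $\mathcal{I}(K)=\mathcal{A}(K)\cup\mathcal{R}(K)$. For $x\in M$ put $J^{+}(x)=\bigcap_{U,\,t>0}\overline{U[t,\infty)}$ and $J^{-}(x)=\bigcap_{U,\,t<0}\overline{U(-\infty,t]}$, with $U$ running over the neighborhoods of $x$, and let $J^*(x)$ be the set of $(y,z)\in M\times M$ for which there are $x_n\to x$, $t_n\to\infty$, $s_n\to-\infty$ with $x_nt_n\to y$ and $x_ns_n\to z$.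 A point $x$ is dissonant if $x\in\mathcal{I}(K)-\mathcal{A}(K)$ and $J^+(x)\cap K\ne\emptyset$, or $x\in\mathcal{I}(K)-\mathcal{R}(K)$ and $J^-(x)\cap K\neq\emptyset$, or $x\notin\mathcal{I}(K)$ and $J^*(x)\cap(K\times K)\neq\emptyset$. Let $N\subset\mathcal{I}(K)$ be an isolating block of $K$, i.e. an isolating neighborhood of $K$ for which there are compact sets $N^i,N^o$ with $\partial N=N^i\cup N^o$ such that each $x\in N^i$ has $x[-\varepsilon,0)\subset M-N$ and each $x\in\partial N-N^i$ has $x[-\varepsilon,0)\subset\mathring N$ for some $\varepsilon>0$, while each $x\in N^o$ has $x(0,\delta]\subset M-N$ and each $x\in\partial N-N^o$ has $x(0,\delta]\subset\mathring N$ for some $\delta>0$. Assume that $N=N^+\cup N^-$, where $N^+=\{x\in N: x[0,\infty)\subset N\}$ and $N^-=\{x\in N: x(-\infty,0]\subset N\}$. Then $\mathcal{I}(K)-K$ has finitely many connected components. Moreover, each component $C$ of $\mathcal{I}(K)-K$ is invariant, and $C$ contains no dissonant point if and only if the restricted flow $\varphi|_C$ is parallelizable, i.e. there is a set $S\subset C$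 (a section) such that $S\times\mathbb{R}\to C$, $(x,t)\mapsto xt$, is a homeomorphism. If $C$ contains no dissonant point, then the section $S$ can be chosen to be a connected component of $\partial N$ (and of $\partial N\cap C$), and the flow provides a strong deformation retraction of $C$ onto $S$: there is a continuous $\tau:C\to\mathbb{R}$ such that $(x,s)\mapsto x(s\,\tau(x))$, $0\le s\le 1$, is a strong deformation retraction of $C$ onto $S$. -/

import Mathlib

open Set Filter Topology TopologicalSpace

universe u

namespace NonSaddle

/-- Absolute neighborhood retracts (in the class of metrizable spaces): `M` is metrizable, and
whenever `h` embeds `M` as a closed subset of a metrizable space `X`, the image `h(M)` is a retract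
of some neighborhood `U` of `h(M)` in `X`. -/
def IsANR (M : Type u) [TopologicalSpace M] : Prop :=
  MetrizableSpace M ∧
    ∀ (X : Type u) [TopologicalSpace X] [MetrizableSpace X] (h : M → X), IsClosedEmbedding h →
      ∃ U : Set X, range h ⊆ interior U ∧
        ∃ r : X → X, ContinuousOn r U ∧ MapsTo r U (range h) ∧ ∀ y ∈ range h, r y = y

/-- `C` is a connected component of the subspace `A`. -/
def IsComponentOf {X : Type u} [TopologicalSpace X] (C A : Set X) : Prop :=
  ∃ x ∈ A, C = connectedComponentIn A x

/-- `S` is a section of the flow `φ`: the map `S × ℝ → X`, `(x, t) ↦ xt`, is a homeomorphism. -/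
def IsSection {X : Type u} [TopologicalSpace X] (φ : Flow ℝ X) (S : Set X) : Prop :=
  IsHomeomorph (fun p : S × ℝ => φ p.2 (p.1 : X))

/-- A flow is parallelizable if it has a section. -/
def IsParallelizable {X : Type u} [TopologicalSpace X] (φ : Flow ℝ X) : Prop :=
  ∃ S : Set X, IsSection φ S

/-- `H` is a strong deformation retraction of `X` onto `S`. -/
structure IsStrongDeformationRetraction {X : Type u} [TopologicalSpace X]
    (H : unitInterval → X → X) (S : Set X) : Prop where
  continuous : Continuous (fun p : unitInterval × X => H p.1 p.2)
  start : ∀ x, H 0 x = x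
  finish : ∀ x, H 1 x ∈ S
  fixed : ∀ s, ∀ x ∈ S, H s x = x

variable {M : Type u} [TopologicalSpace M]

/-- The positive semi-trajectory of `x`. -/
def posSemi (φ : Flow ℝ M) (x : M) : Set M := (fun t : ℝ => φ t x) '' Ici 0

/-- The negative semi-trajectory of `x`. -/
def negSemi (φ : Flow ℝ M) (x : M) : Set M := (fun t : ℝ => φ t x) '' Iic 0

/-- The omega-limit of `x`. -/
def posLimit (φ : Flow ℝ M) (x : M) : Set M := omegaLimit atTop φ {x}

/-- The negative omega-limit of `x`. -/
def negLimit (φ : Flow ℝ M) (x : M) : Set M := omegaLimit atBot φ {x}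

/-- The positive prolongational limit set: the intersection of the closures of `U[t, ∞)`
over all neighborhoods `U` of `x` and all `t > 0`. -/
def posProlong (φ : Flow ℝ M) (x : M) : Set M :=
  ⋂ U ∈ 𝓝 x, ⋂ t > (0 : ℝ), closure (image2 φ (Ici t) U)

/-- The negative prolongational limit set: the intersection of the closures of `U(-∞, t]`
over all neighborhoods `U` of `x` and all `t < 0`. -/
def negProlong (φ : Flow ℝ M) (x : M) : Set M :=
  ⋂ U ∈ 𝓝 x, ⋂ t < (0 : ℝ), closure (image2 φ (Iic t) U)

/-- The two-sided prolongational limit set. -/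
def twoSidedProlong (φ : Flow ℝ M) (x : M) : Set (M × M) :=
  {p | ∃ (u : ℕ → M) (t s : ℕ → ℝ), Tendsto u atTop (𝓝 x) ∧ Tendsto t atTop atTop ∧
    Tendsto s atTop atBot ∧ Tendsto (fun n => φ (t n) (u n)) atTop (𝓝 p.1) ∧
    Tendsto (fun n => φ (s n) (u n)) atTop (𝓝 p.2)}

/-- `N` is an isolating neighborhood of the compact set `K`: a compact neighborhood of `K` such
that `K` is the maximal invariant subset of `N`. -/
structure IsIsolatingNhd (φ : Flow ℝ M) (N K : Set M) : Prop where
  isCompact : IsCompact N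
  nhd : K ⊆ interior N
  invariant : IsInvariant φ K
  maximal : ∀ L ⊆ N, IsInvariant φ L → L ⊆ K

/-- Isolated invariant (compact) sets. -/
structure IsIsolatedInvariant (φ : Flow ℝ M) (K : Set M) : Prop where
  isCompact : IsCompact K
  invariant : IsInvariant φ K
  isolated : ∃ N, IsIsolatingNhd φ N K

/-- Isolating blocks: isolating neighborhoods with an entrance set `Ni` and an exit set `No`. -/
def IsIsolatingBlock (φ : Flow ℝ M) (N K : Set M) : Prop :=
  IsIsolatingNhd φ N K ∧
    ∃ Ni No : Set M, IsCompact Ni ∧ IsCompact No ∧ frontier N = Ni ∪ No ∧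
      (∀ x ∈ Ni, ∃ ε > (0 : ℝ), ∀ t ∈ Ico (-ε) 0, φ t x ∉ N) ∧
      (∀ x ∈ No, ∃ δ > (0 : ℝ), ∀ t ∈ Ioc 0 δ, φ t x ∉ N) ∧
      (∀ x ∈ frontier N \ Ni, ∃ ε > (0 : ℝ), ∀ t ∈ Ico (-ε) 0, φ t x ∈ interior N) ∧
      (∀ x ∈ frontier N \ No, ∃ δ > (0 : ℝ), ∀ t ∈ Ioc 0 δ, φ t x ∈ interior N)

/-- The positively invariant part `N⁺` of `N`. -/
def posPart (φ : Flow ℝ M) (N : Set M) : Set M := {x ∈ N | posSemi φ x ⊆ N}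

/-- The negatively invariant part `N⁻` of `N`. -/
def negPart (φ : Flow ℝ M) (N : Set M) : Set M := {x ∈ N | negSemi φ x ⊆ N}

/-- Saddle sets: some neighborhood `U` of `K` is such that every neighborhood of `K` contains a
point whose two semi-trajectories both leave `U`. -/
def IsSaddle (φ : Flow ℝ M) (K : Set M) : Prop :=
  ∃ U ∈ 𝓝ˢ K, ∀ V ∈ 𝓝ˢ K, ∃ x ∈ V, ¬ posSemi φ x ⊆ U ∧ ¬ negSemi φ x ⊆ U

/-- The stable manifold of `K`. -/
def stableSet (φ : Flow ℝ M) (K : Set M) : Set M :=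
  {x | (posLimit φ x).Nonempty ∧ posLimit φ x ⊆ K}

/-- The unstable manifold of `K`. -/
def unstableSet (φ : Flow ℝ M) (K : Set M) : Set M :=
  {x | (negLimit φ x).Nonempty ∧ negLimit φ x ⊆ K}

/-- The region of influence of `K`. -/
def influence (φ : Flow ℝ M) (K : Set M) : Set M := stableSet φ K ∪ unstableSet φ K

/-- Positively dissonant points. -/
def posDissonant (φ : Flow ℝ M) (K : Set M) : Set M :=
  {x ∈ influence φ K | x ∉ stableSet φ K ∧ (posProlong φ x ∩ K).Nonempty}

/-- Negatively dissonant points. -/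
def negDissonant (φ : Flow ℝ M) (K : Set M) : Set M :=
  {x ∈ influence φ K | x ∉ unstableSet φ K ∧ (negProlong φ x ∩ K).Nonempty}

/-- Externally dissonant points. -/
def extDissonant (φ : Flow ℝ M) (K : Set M) : Set M :=
  {x | x ∉ influence φ K ∧ (twoSidedProlong φ x ∩ K ×ˢ K).Nonempty}

/-- The set of all dissonant points of `K`. -/
def dissonant (φ : Flow ℝ M) (K : Set M) : Set M :=
  posDissonant φ K ∪ negDissonant φ K ∪ extDissonant φ K

end NonSaddle

namespace NonSaddle

/-! Write `A`, `R` for the stable and unstable sets with `K` removed, and `E`, `F` for the entrance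
and exit sets of the block. Since the block is the union of `N⁺` and `N⁻`, points of its interior
outside the closed set `N⁻` lie in `N⁺`, and `A` is the union of the flow translates of this open
set (`stableSet_diff_eq`). So `A` is open, and each orbit in it meets the compact set `E` exactly
once, at a continuously varying time (`exists_isCrossSection`). Time reversal gives the same for `R`
and `F`.

An ANR is locally connected, so the components of the open set `A ∪ R` are open. Each meets the
compact set `E ∪ F`, hence there are finitely many.

A point of a component `C` lying in the closure of `A` but not in `A` is positively dissonant.
Without dissonance, connectedness therefore puts `C` inside `A` or inside `R`, and `E ∩ C` or `F ∩
C` is a section. Conversely, a section of `C` yields a clock growing at unit speed along orbits. It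
is bounded on the compact set `E ∩ C`, whereas near a positively dissonant point there would be
orbits reaching `E` arbitrarily late. -/

/-! ### Local connectedness of ANRs -/

/-- The truncated Kuratowski embedding `x ↦ min (dist x ·) 1`. -/
noncomputable def truncDist {M : Type u} [MetricSpace M] (x : M) : BoundedContinuousFunction M ℝ :=
  BoundedContinuousFunction.ofNormedAddCommGroup (fun y => min (dist x y) 1) (by fun_prop) 1
    (fun y => by
      rw [Real.norm_eq_abs, abs_of_nonneg (le_min dist_nonneg zero_le_one)]
      exact min_le_right _ _)

theorem truncDist_apply {M : Type u} [MetricSpace M] (x y : M) :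
    truncDist x y = min (dist x y) 1 := rfl

theorem isEmbedding_truncDist {M : Type u} [MetricSpace M] :
    IsEmbedding (truncDist : M → BoundedContinuousFunction M ℝ) := by
  refine (Metric.isUniformEmbedding_iff'.2 ⟨fun ε hε => ⟨ε / 2, by positivity, ?_⟩,
    fun δ hδ => ⟨min δ 1, by positivity, ?_⟩⟩).isEmbedding
  · intro a b hab
    refine lt_of_le_of_lt ((BoundedContinuousFunction.dist_le (by positivity)).2 fun y => ?_)
      (half_lt_self hε)
    rw [truncDist_apply, truncDist_apply, Real.dist_eq]
    refine (abs_min_sub_min_le_max _ _ _ _).trans ?_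
    rw [sub_self, abs_zero, max_eq_left (abs_nonneg _)]
    exact (abs_dist_sub_le a b y).trans hab.le
  · intro a b hab
    have h := (BoundedContinuousFunction.dist_coe_le_dist (f := truncDist a) (g := truncDist b)
      b).trans_lt hab
    rw [truncDist_apply, truncDist_apply, dist_self, min_eq_left zero_le_one, Real.dist_0_eq_abs,
      abs_of_nonneg (le_min dist_nonneg zero_le_one)] at h
    rcases min_lt_iff.1 h with h | h
    · exact h.trans_le (min_le_left _ _)
    · exact absurd h (not_lt.2 (min_le_right _ _))

/-- A set `Y` in a normed space `E`, placed at height `0` below the open half-space `E × (0, ∞)`. -/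
def cappedHalfSpace {E : Type u} (Y : Set E) : Set (E × ℝ) :=
  {p | 0 ≤ p.2 ∧ (p.2 = 0 → p.1 ∈ Y)}

/-- The ball is star-shaped about the point at height `r / 2` above its centre: a segment from there
has positive height except possibly at its far end, so the restriction at height `0` matters only at
that end. -/
theorem isPreconnected_ball_cappedHalfSpace {E : Type u} [NormedAddCommGroup E] [NormedSpace ℝ E]
    (Y : Set E) (p : cappedHalfSpace Y) (hp : p.1.2 = 0) {r : ℝ} (hr : 0 < r) :
    IsPreconnected (Metric.ball p r) := by
  rw [← IsInducing.subtypeVal.isPreconnected_image]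
  have himg : Subtype.val '' Metric.ball p r = Metric.ball p.1 r ∩ cappedHalfSpace Y := by
    ext q
    constructor
    · rintro ⟨q, hq, rfl⟩
      exact ⟨hq, q.2⟩
    · rintro ⟨hq, hq'⟩
      exact ⟨⟨q, hq'⟩, hq, rfl⟩
  rw [himg]
  have hmem : ((p.1.1, r / 2) : E × ℝ) ∈ Metric.ball p.1 r := by
    rw [Metric.mem_ball, Prod.dist_eq, hp]
    simp [abs_of_pos hr, hr]
  have hcap : ((p.1.1, r / 2) : E × ℝ) ∈ cappedHalfSpace Y :=
    ⟨by show 0 ≤ r / 2; positivity, fun h => absurd h (by show r / 2 ≠ 0; positivity)⟩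
  suffices hstar : StarConvex ℝ (p.1.1, r / 2) (Metric.ball p.1 r ∩ cappedHalfSpace Y) from
    (hstar.isPathConnected ⟨hmem, hcap⟩).isConnected.isPreconnected
  rintro q ⟨hq, hq0, hq1⟩ a b ha hb hab
  refine ⟨convex_ball _ _ hmem hq ha hb hab, ?_, ?_⟩
  · show 0 ≤ a * (r / 2) + b * q.2
    positivity
  · show a * (r / 2) + b * q.2 = 0 → a • p.1.1 + b • q.1 ∈ Y
    intro h
    have ha0 : a = 0 := by
      by_contra hne
      have : 0 < a := lt_of_le_of_ne ha (Ne.symm hne)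
      have : 0 < a * (r / 2) + b * q.2 := by positivity
      exact this.ne' h
    have hb1 : b = 1 := by linarith
    subst ha0 hb1
    simp only [zero_mul, one_mul, zero_add] at h
    simpa using hq1 h

/-- The slice at height `0` is a closed copy of `M`, even if `M` is not closed in the normed space.
Small balls around its points are connected, and the retraction carries them to small connected
neighborhoods in `M`. -/
theorem IsANR.locallyConnectedSpace {M : Type u} [TopologicalSpace M] (hM : IsANR M) :
    LocallyConnectedSpace M := by
  obtain ⟨hmet, hret⟩ := hM
  let _ := metrizableSpaceMetric M
  let X := cappedHalfSpace (range (truncDist : M → BoundedContinuousFunction M ℝ))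
  let h : M → X := fun m => ⟨(truncDist m, 0), le_rfl, fun _ => mem_range_self m⟩
  have hind : IsInducing h := by
    refine IsInducing.of_comp (g := fun p : X => p.1.1) ?_ (by fun_prop)
      isEmbedding_truncDist.isInducing
    exact Continuous.subtype_mk (isEmbedding_truncDist.continuous.prodMk continuous_const) _
  have hinj : Function.Injective h := fun a b hab =>
    isEmbedding_truncDist.injective (congrArg (fun p : X => p.1.1) hab)
  have hrange : range h = {p : X | p.1.2 = 0} := by
    ext p
    constructor
    · rintro ⟨m, rfl⟩
      rfl
    · intro hp
      obtain ⟨m, hm⟩ := p.2.2 hp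
      exact ⟨m, Subtype.ext (Prod.ext hm (Eq.symm hp))⟩
  obtain ⟨U, hU, r, hrc, hrU, hrfix⟩ := hret X h ⟨⟨hind, hinj⟩, by
    rw [hrange]
    exact isClosed_eq (by fun_prop) continuous_const⟩
  rw [locallyConnectedSpace_iff_connected_subsets]
  intro m W hW
  obtain ⟨O, hO, hOW⟩ := (hind.nhds_eq_comap m ▸ hW : W ∈ comap h (𝓝 (h m)))
  have hUm : U ∈ 𝓝 (h m) := mem_interior_iff_mem_nhds.1 (hU (mem_range_self m))
  have hrm : ContinuousAt r (h m) := hrc.continuousAt hUm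
  have hpre : r ⁻¹' O ∈ 𝓝 (h m) := hrm (by rwa [hrfix _ (mem_range_self m)])
  obtain ⟨ε, hε, hball⟩ := Metric.mem_nhds_iff.1 (inter_mem hUm hpre)
  have himg : h '' (h ⁻¹' (r '' Metric.ball (h m) ε)) = r '' Metric.ball (h m) ε := by
    rw [image_preimage_eq_of_subset]
    rintro _ ⟨p, hp, rfl⟩
    exact hrU (hball hp).1
  refine ⟨h ⁻¹' (r '' Metric.ball (h m) ε), ?_, ?_, ?_⟩
  · refine mem_of_superset (hind.continuous.continuousAt (Metric.ball_mem_nhds (h m) hε))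
      fun y hy => ⟨h y, hy, hrfix _ (mem_range_self y)⟩
  · rw [← hind.isPreconnected_image, himg]
    exact (isPreconnected_ball_cappedHalfSpace _ (h m) rfl hε).image r
      (hrc.mono fun p hp => (hball hp).1)
  · rintro y ⟨p, hp, hpy⟩
    apply hOW
    show h y ∈ O
    rw [← hpy]
    exact (hball hp).2

/-! ### Positive and negative parts, and time reversal -/

variable {M : Type u} [TopologicalSpace M]

theorem mem_posPart_iff {φ : Flow ℝ M} {N : Set M} {x : M} :
    x ∈ posPart φ N ↔ ∀ t : ℝ, 0 ≤ t → φ t x ∈ N := by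
  constructor
  · rintro ⟨-, hx⟩ t ht
    exact hx ⟨t, ht, rfl⟩
  · intro h
    refine ⟨by simpa using h 0 le_rfl, ?_⟩
    rintro _ ⟨t, ht, rfl⟩
    exact h t ht

theorem mem_negPart_iff {φ : Flow ℝ M} {N : Set M} {x : M} :
    x ∈ negPart φ N ↔ ∀ t : ℝ, t ≤ 0 → φ t x ∈ N := by
  constructor
  · rintro ⟨-, hx⟩ t ht
    exact hx ⟨t, ht, rfl⟩
  · intro h
    refine ⟨by simpa using h 0 le_rfl, ?_⟩
    rintro _ ⟨t, ht, rfl⟩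
    exact h t ht

theorem posPart_reverse (φ : Flow ℝ M) (N : Set M) : posPart φ.reverse N = negPart φ N := by
  ext x
  rw [mem_posPart_iff, mem_negPart_iff]
  exact ⟨fun h t ht => by simpa using h (-t) (by linarith),
    fun h t ht => h (-t) (by linarith)⟩

theorem negPart_reverse (φ : Flow ℝ M) (N : Set M) : negPart φ.reverse N = posPart φ N := by
  ext x
  rw [mem_posPart_iff, mem_negPart_iff]
  exact ⟨fun h t ht => by simpa using h (-t) (by linarith),
    fun h t ht => h (-t) (by linarith)⟩

theorem posLimit_reverse (φ : Flow ℝ M) (x : M) : posLimit φ.reverse x = negLimit φ x := by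
  refine Subset.antisymm (omegaLimit_subset_of_tendsto (fun t x => φ t x) {x}
    tendsto_neg_atTop_atBot) ?_
  have h := omegaLimit_subset_of_tendsto (fun t x => φ.reverse t x) {x}
    (tendsto_neg_atBot_atTop (G := ℝ))
  simp only [Flow.reverse_apply, neg_neg] at h
  exact h

theorem stableSet_reverse (φ : Flow ℝ M) (K : Set M) :
    stableSet φ.reverse K = unstableSet φ K := by
  simp only [stableSet, unstableSet, posLimit_reverse]

theorem unstableSet_reverse (φ : Flow ℝ M) (K : Set M) :
    unstableSet φ.reverse K = stableSet φ K := by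
  rw [← stableSet_reverse]
  congr 1
  ext t x
  simp

theorem influence_reverse (φ : Flow ℝ M) (K : Set M) :
    influence φ.reverse K = influence φ K := by
  rw [influence, influence, stableSet_reverse, unstableSet_reverse, union_comm]

theorem posProlong_reverse (φ : Flow ℝ M) (x : M) : posProlong φ.reverse x = negProlong φ x := by
  have himg : ∀ (t : ℝ) (U : Set M), image2 φ.reverse (Ici t) U = image2 φ (Iic (-t)) U := by
    intro t U
    ext y
    constructor
    · rintro ⟨s, hs, u, hu, rfl⟩
      exact ⟨-s, neg_le_neg (mem_Ici.1 hs), u, hu, rfl⟩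
    · rintro ⟨s, hs, u, hu, rfl⟩
      exact ⟨-s, le_neg_of_le_neg (mem_Iic.1 hs), u, hu, by simp⟩
  ext y
  simp only [posProlong, negProlong, mem_iInter, himg]
  exact ⟨fun h U hU t ht => by simpa using h U hU (-t) (by linarith),
    fun h U hU t ht => h U hU (-t) (by linarith)⟩

theorem posDissonant_reverse (φ : Flow ℝ M) (K : Set M) :
    posDissonant φ.reverse K = negDissonant φ K := by
  simp only [posDissonant, negDissonant, influence_reverse, stableSet_reverse, posProlong_reverse]

theorem isInvariant_reverse_iff {φ : Flow ℝ M} {L : Set M} :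
    IsInvariant φ.reverse L ↔ IsInvariant φ L :=
  ⟨fun h t x hx => by simpa using h (-t) hx, fun h t x hx => h (-t) hx⟩

theorem mem_of_flow_mem {φ : Flow ℝ M} {L : Set M} (hL : IsInvariant φ L) {t : ℝ} {x : M}
    (h : φ t x ∈ L) : x ∈ L := by
  have := hL (-t) h
  rwa [← φ.map_add, neg_add_cancel, φ.map_zero_apply] at this

/-! ### Orbits in a split block -/

/-- An isolating block with entrance set `E` and exit set `F`, all of whose points stay in the block
in positive or in negative time. -/
structure IsSplitBlock (φ : Flow ℝ M) (N K E F : Set M) : Prop where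
  isolating : IsIsolatingNhd φ N K
  frontier_eq : frontier N = E ∪ F
  entrance_isCompact : IsCompact E
  exit_isCompact : IsCompact F
  entrance : ∀ x ∈ E, ∃ ε > (0 : ℝ), ∀ t ∈ Ico (-ε) 0, φ t x ∉ N
  exit : ∀ x ∈ F, ∃ δ > (0 : ℝ), ∀ t ∈ Ioc 0 δ, φ t x ∉ N
  split : N ⊆ posPart φ N ∪ negPart φ N

namespace IsSplitBlock

variable {φ : Flow ℝ M} {N K E F : Set M}

theorem reverse (h : IsSplitBlock φ N K E F) : IsSplitBlock φ.reverse N K F E where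
  isolating := ⟨h.isolating.isCompact, h.isolating.nhd,
    isInvariant_reverse_iff.2 h.isolating.invariant,
    fun L hL hinv => h.isolating.maximal L hL (isInvariant_reverse_iff.1 hinv)⟩
  frontier_eq := by rw [h.frontier_eq, union_comm]
  entrance_isCompact := h.exit_isCompact
  exit_isCompact := h.entrance_isCompact
  entrance x hx := by
    obtain ⟨δ, hδ, hout⟩ := h.exit x hx
    exact ⟨δ, hδ, fun t ht => hout (-t) ⟨by linarith [ht.2], by linarith [ht.1]⟩⟩
  exit x hx := by
    obtain ⟨ε, hε, hout⟩ := h.entrance x hx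
    exact ⟨ε, hε, fun t ht => hout (-t) ⟨by linarith [ht.2], by linarith [ht.1]⟩⟩
  split := by
    rw [posPart_reverse, negPart_reverse, union_comm]
    exact h.split

theorem subset (h : IsSplitBlock φ N K E F) : K ⊆ N :=
  h.isolating.nhd.trans interior_subset

theorem flow_mem_iff (h : IsSplitBlock φ N K E F) {t : ℝ} {x : M} : φ t x ∈ K ↔ x ∈ K :=
  ⟨mem_of_flow_mem h.isolating.invariant, fun hx => h.isolating.invariant t hx⟩

theorem mem_of_orbit_subset (h : IsSplitBlock φ N K E F) {x : M} (hx : ∀ t : ℝ, φ t x ∈ N) :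
    x ∈ K := by
  refine h.isolating.maximal (range fun t : ℝ => φ t x) ?_ ?_ ⟨0, φ.map_zero_apply x⟩
  · rintro _ ⟨t, rfl⟩
    exact hx t
  · rintro s _ ⟨t, rfl⟩
    exact ⟨s + t, φ.map_add s t x⟩

theorem posPart_inter_negPart_subset (h : IsSplitBlock φ N K E F) :
    posPart φ N ∩ negPart φ N ⊆ K := by
  rintro x ⟨hp, hn⟩
  refine h.mem_of_orbit_subset fun t => ?_
  rcases le_total 0 t with ht | ht
  · exact mem_posPart_iff.1 hp t ht
  · exact mem_negPart_iff.1 hn t ht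

theorem subset_negPart (h : IsSplitBlock φ N K E F) : K ⊆ negPart φ N := fun _ hx =>
  mem_negPart_iff.2 fun _ _ => h.subset (h.flow_mem_iff.2 hx)

theorem flow_mem_posPart {s t : ℝ} {x : M} (hx : φ s x ∈ posPart φ N)
    (hst : s ≤ t) : φ t x ∈ posPart φ N := by
  rw [mem_posPart_iff] at hx ⊢
  intro r hr
  have := hx (r + t - s) (by linarith)
  rwa [← φ.map_add, sub_add_cancel, φ.map_add] at this

theorem interior_diff_subset (h : IsSplitBlock φ N K E F) :
    interior N \ negPart φ N ⊆ posPart φ N := fun _ hx =>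
  (h.split (interior_subset hx.1)).resolve_right hx.2

/-- The orbit returns to the interior at arbitrarily late times. If it were in `N⁻` at each return,
its whole past would lie in `N`, hence the entire orbit, forcing `x ∈ K`. -/
theorem exists_flow_mem_interior_diff (h : IsSplitBlock φ N K E F) {x : M}
    (hx : x ∈ stableSet φ K) (hxK : x ∉ K) :
    ∃ t, φ t x ∈ interior N \ negPart φ N := by
  obtain ⟨⟨y, hy⟩, hsub⟩ := hx
  by_contra! hcon
  apply hxK
  refine h.mem_of_orbit_subset fun s => ?_
  have hfreq := (mem_omegaLimit_singleton_iff_mapClusterPt _ _ _ _).1 hy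
  have hint : ∃ᶠ t in atTop, φ t x ∈ interior N :=
    mapClusterPt_iff_frequently.1 hfreq _ (isOpen_interior.mem_nhds (h.isolating.nhd (hsub hy)))
  obtain ⟨t, ht, hst⟩ := (hint.and_eventually (eventually_ge_atTop s)).exists
  have hneg : φ t x ∈ negPart φ N := by
    by_contra hn
    exact hcon t ⟨ht, hn⟩
  have := mem_negPart_iff.1 hneg (s - t) (by linarith)
  rwa [← φ.map_add, sub_add_cancel] at this

theorem disjoint_frontier (h : IsSplitBlock φ N K E F) : Disjoint K (frontier N) := by
  rw [disjoint_left]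
  intro x hx hfr
  exact hfr.2 (h.isolating.nhd hx)

theorem posPart_inter_frontier_subset (h : IsSplitBlock φ N K E F) :
    posPart φ N ∩ frontier N ⊆ E := by
  rintro x ⟨hx, hfr⟩
  refine (h.frontier_eq ▸ hfr : x ∈ E ∪ F).resolve_right fun hF => ?_
  obtain ⟨δ, hδ, hout⟩ := h.exit x hF
  exact hout δ ⟨hδ, le_rfl⟩ (mem_posPart_iff.1 hx _ hδ.le)

theorem entrance_le (h : IsSplitBlock φ N K E F) {s t : ℝ} {x : M} (hs : φ s x ∈ E)
    (ht : φ t x ∈ posPart φ N) : s ≤ t := by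
  by_contra! hlt
  obtain ⟨ε, hε, hout⟩ := h.entrance _ hs
  -- This time is within `ε` before the entrance at `s`, but not before `t`, when the orbit is
  -- already trapped in `N`.
  refine hout (max (-ε) (t - s)) ⟨le_max_left _ _, max_lt (by linarith) (by linarith)⟩ ?_
  rw [← φ.map_add]
  refine (flow_mem_posPart ht ?_).1
  linarith [le_max_right (-ε) (t - s)]

variable [T2Space M]

theorem isClosed (h : IsSplitBlock φ N K E F) : IsClosed N := h.isolating.isCompact.isClosed

theorem isClosed_posPart (h : IsSplitBlock φ N K E F) : IsClosed (posPart φ N) := by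
  have : posPart φ N = ⋂ t ∈ Ici (0 : ℝ), (fun x => φ t x) ⁻¹' N := by
    ext x
    simp [mem_posPart_iff]
  rw [this]
  exact isClosed_biInter fun t _ => h.isClosed.preimage (by fun_prop)

theorem isClosed_negPart (h : IsSplitBlock φ N K E F) : IsClosed (negPart φ N) := by
  rw [← posPart_reverse]
  exact h.reverse.isClosed_posPart

theorem isOpen_interior_diff (h : IsSplitBlock φ N K E F) :
    IsOpen (interior N \ negPart φ N) :=
  isOpen_interior.sdiff h.isClosed_negPart

theorem mem_stableSet (h : IsSplitBlock φ N K E F) {t : ℝ} {x : M} (hx : φ t x ∈ posPart φ N) :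
    x ∈ stableSet φ K := by
  have himg : image2 φ (Ici t) {x} ⊆ N := by
    rintro _ ⟨s, hs, y, rfl, rfl⟩
    exact (flow_mem_posPart hx hs).1
  have hcl : closure (image2 φ (Ici t) {x}) ⊆ N := closure_minimal himg h.isClosed
  refine ⟨nonempty_omegaLimit_of_isCompact_absorbing _ _ _ h.isolating.isCompact
    ⟨Ici t, Ici_mem_atTop t, hcl⟩ (singleton_nonempty x), ?_⟩
  refine h.isolating.maximal _
    ((omegaLimit_subset_closure_image2 _ _ _ (Ici_mem_atTop t)).trans hcl) ?_
  exact φ.isInvariant_omegaLimit _ _ fun s => tendsto_atTop_add_const_left _ s tendsto_id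

theorem stableSet_diff_eq (h : IsSplitBlock φ N K E F) :
    stableSet φ K \ K = ⋃ t : ℝ, (fun x => φ t x) ⁻¹' (interior N \ negPart φ N) := by
  ext x
  rw [mem_iUnion]
  constructor
  · rintro ⟨hx, hxK⟩
    exact h.exists_flow_mem_interior_diff hx hxK
  · rintro ⟨t, ht⟩
    exact ⟨h.mem_stableSet (h.interior_diff_subset ht),
      fun hxK => ht.2 (h.subset_negPart (h.flow_mem_iff.2 hxK))⟩

theorem isOpen_stableSet_diff (h : IsSplitBlock φ N K E F) : IsOpen (stableSet φ K \ K) := by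
  rw [h.stableSet_diff_eq]
  exact isOpen_iUnion fun t => h.isOpen_interior_diff.preimage (by fun_prop)

theorem isInvariant_stableSet_diff (h : IsSplitBlock φ N K E F) :
    IsInvariant φ (stableSet φ K \ K) := by
  rw [h.stableSet_diff_eq]
  intro s x hx
  obtain ⟨t, ht⟩ := mem_iUnion.1 hx
  refine mem_iUnion.2 ⟨t - s, ?_⟩
  rw [mem_preimage] at ht ⊢
  rwa [← φ.map_add, sub_add_cancel]

theorem frontier_subset (h : IsSplitBlock φ N K E F) : frontier N ⊆ N := h.isClosed.frontier_subset

/-- Just before an entrance point the orbit is outside `N`, which excludes `N⁻`. -/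
theorem entrance_subset_posPart (h : IsSplitBlock φ N K E F) : E ⊆ posPart φ N := by
  intro x hx
  refine (h.split (h.frontier_subset (h.frontier_eq ▸ Or.inl hx))).resolve_right fun hn => ?_
  obtain ⟨ε, hε, hout⟩ := h.entrance x hx
  exact hout (-ε) ⟨le_rfl, by linarith⟩ (mem_negPart_iff.1 hn _ (by linarith))

theorem disjoint_entrance_exit (h : IsSplitBlock φ N K E F) : Disjoint E F := by
  rw [disjoint_left]
  intro x hE hF
  obtain ⟨δ, hδ, hout⟩ := h.exit x hF
  exact hout δ ⟨hδ, le_rfl⟩ (mem_posPart_iff.1 (h.entrance_subset_posPart hE) _ hδ.le)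

theorem entrance_subset_stableSet_diff (h : IsSplitBlock φ N K E F) : E ⊆ stableSet φ K \ K := by
  intro x hx
  refine ⟨h.mem_stableSet (t := 0) ?_, fun hK => ?_⟩
  · rw [φ.map_zero_apply]
    exact h.entrance_subset_posPart hx
  · exact disjoint_left.1 h.disjoint_frontier hK (h.frontier_eq ▸ Or.inl hx)

/-- The entrance happens at the first time in `N⁺`. This time exists because `N⁺` is closed and an
orbit in `N⁺` at arbitrarily early times would lie in `K`. -/
theorem exists_flow_mem_entrance (h : IsSplitBlock φ N K E F) {x : M}
    (hx : x ∈ stableSet φ K \ K) : ∃ s, φ s x ∈ E := by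
  obtain ⟨t, ht⟩ := h.exists_flow_mem_interior_diff hx.1 hx.2
  let P : Set ℝ := {t | φ t x ∈ posPart φ N}
  have hPne : P.Nonempty := ⟨t, h.interior_diff_subset ht⟩
  have hPcl : IsClosed P := h.isClosed_posPart.preimage (by fun_prop)
  have hPb : BddBelow P := by
    by_contra hnb
    apply hx.2
    refine h.mem_of_orbit_subset fun r => ?_
    obtain ⟨s, hs, hsr⟩ := not_bddBelow_iff.1 hnb r
    exact (flow_mem_posPart hs hsr.le).1
  have hmem : sInf P ∈ P := hPcl.csInf_mem hPne hPb
  refine ⟨sInf P, h.posPart_inter_frontier_subset ⟨hmem, subset_closure hmem.1, fun hint => ?_⟩⟩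
  have hcont : ContinuousAt (fun s : ℝ => φ s x) (sInf P) := by fun_prop
  obtain ⟨ε, hε, hball⟩ := Metric.mem_nhds_iff.1 (hcont (isOpen_interior.mem_nhds hint))
  -- At an interior point the orbit could be followed backwards a little inside `N`, contradicting
  -- minimality.
  have hlow : sInf P - ε / 2 ∈ P := by
    refine mem_posPart_iff.2 fun r hr => ?_
    rw [← φ.map_add]
    by_cases hc : sInf P ≤ r + (sInf P - ε / 2)
    · exact (flow_mem_posPart hmem hc).1
    · refine interior_subset (hball ?_)
      rw [Metric.mem_ball, Real.dist_eq, abs_lt]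
      constructor <;> linarith
  linarith [csInf_le hPb hlow]

end IsSplitBlock

/-! ### Compact cross-sections -/

/-- `E` is a section of the flow on the open invariant set `A`, and `σ` is the time that a point of
`A` needs to reach `E`. -/
structure IsCrossSection (φ : Flow ℝ M) (A E : Set M) (σ : M → ℝ) : Prop where
  isOpen : IsOpen A
  invariant : IsInvariant φ A
  isCompact : IsCompact E
  subset : E ⊆ A
  continuousOn : ContinuousOn σ A
  flow_mem : ∀ x ∈ A, φ (σ x) x ∈ E
  unique : ∀ x ∈ A, ∀ t, φ t x ∈ E → t = σ x

theorem IsCrossSection.of_reverse {φ : Flow ℝ M} {A E : Set M} {σ : M → ℝ}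
    (h : IsCrossSection φ.reverse A E σ) : IsCrossSection φ A E (fun x => -σ x) where
  isOpen := h.isOpen
  invariant := isInvariant_reverse_iff.1 h.invariant
  isCompact := h.isCompact
  subset := h.subset
  continuousOn := h.continuousOn.neg
  flow_mem := h.flow_mem
  unique x hx t ht := by
    rw [← h.unique x hx (-t) (by simpa using ht), neg_neg]

theorem IsSplitBlock.exists_isCrossSection [T2Space M] {φ : Flow ℝ M} {N K E F : Set M}
    (h : IsSplitBlock φ N K E F) : ∃ σ, IsCrossSection φ (stableSet φ K \ K) E σ := by
  classical
  have hex : ∀ x, ∃ s, x ∈ stableSet φ K \ K → φ s x ∈ E := fun x => by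
    by_cases hx : x ∈ stableSet φ K \ K
    · obtain ⟨s, hs⟩ := h.exists_flow_mem_entrance hx
      exact ⟨s, fun _ => hs⟩
    · exact ⟨0, fun hx' => absurd hx' hx⟩
  choose σ hσ using hex
  refine ⟨σ, h.isOpen_stableSet_diff, h.isInvariant_stableSet_diff, h.entrance_isCompact,
    h.entrance_subset_stableSet_diff, ?_, hσ, fun x hx t ht => ?_⟩
  · intro x hx
    -- With the next line: `σ y ≤ a` exactly when `φ a y ∈ N⁺`. Closedness of `N⁺` then bounds `σ`
    -- from below near `x`, and openness of `interior N \ negPart φ N` bounds it from above.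
    have hle : ∀ y ∈ stableSet φ K \ K, ∀ a, φ a y ∈ posPart φ N → σ y ≤ a := fun y hy a ha =>
      h.entrance_le (hσ y hy) ha
    have hge : ∀ y ∈ stableSet φ K \ K, ∀ a, σ y ≤ a → φ a y ∈ posPart φ N := fun y hy a ha =>
      IsSplitBlock.flow_mem_posPart (h.entrance_subset_posPart (hσ y hy)) ha
    refine tendsto_order.2 ⟨fun a ha => ?_, fun a ha => ?_⟩
    · have hopen : IsOpen ((fun y => φ a y) ⁻¹' (posPart φ N)ᶜ) :=
        h.isClosed_posPart.isOpen_compl.preimage (by fun_prop)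
      filter_upwards [self_mem_nhdsWithin, mem_nhdsWithin_of_mem_nhds
        (hopen.mem_nhds fun hmem => (hle x hx a hmem).not_gt ha)] with y hy hya
      by_contra! hcon
      exact hya (hge y hy a hcon)
    · have hopen : IsOpen ((fun y => φ a y) ⁻¹' (interior N \ negPart φ N)) :=
        h.isOpen_interior_diff.preimage (by fun_prop)
      have hpos := hge x hx a ha.le
      have hxa : φ a x ∈ interior N \ negPart φ N := by
        refine ⟨?_, fun hn => hx.2 (h.flow_mem_iff.1 (h.posPart_inter_negPart_subset ⟨hpos, hn⟩))⟩
        by_contra hint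
        have hE := h.posPart_inter_frontier_subset ⟨hpos, subset_closure hpos.1, hint⟩
        exact (h.entrance_le hE (hge x hx _ le_rfl)).not_gt ha
      filter_upwards [self_mem_nhdsWithin, mem_nhdsWithin_of_mem_nhds (hopen.mem_nhds hxa)]
        with y hy hya
      refine lt_of_le_of_ne (hle y hy a (h.interior_diff_subset hya)) fun heq => ?_
      have : φ a y ∈ frontier N := h.frontier_eq ▸ Or.inl (heq ▸ hσ y hy)
      exact this.2 hya.1
  · exact le_antisymm (h.entrance_le ht (h.entrance_subset_posPart (hσ x hx)))
      (h.entrance_le (hσ x hx) (h.entrance_subset_posPart ht))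

/-! ### Components of open sets -/

theorem IsComponentOf.isPreconnected {C A : Set M} (h : IsComponentOf C A) : IsPreconnected C := by
  obtain ⟨x, -, rfl⟩ := h
  exact isPreconnected_connectedComponentIn

theorem IsComponentOf.subset {C A : Set M} (h : IsComponentOf C A) : C ⊆ A := by
  obtain ⟨x, -, rfl⟩ := h
  exact connectedComponentIn_subset _ _

theorem IsComponentOf.nonempty {C A : Set M} (h : IsComponentOf C A) : C.Nonempty := by
  obtain ⟨x, hx, rfl⟩ := h
  exact ⟨x, mem_connectedComponentIn hx⟩

theorem IsComponentOf.isOpen [LocallyConnectedSpace M] {C A : Set M} (h : IsComponentOf C A)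
    (hA : IsOpen A) : IsOpen C := by
  obtain ⟨x, -, rfl⟩ := h
  exact hA.connectedComponentIn

theorem IsComponentOf.subset_of_inter_nonempty {C A D : Set M} (h : IsComponentOf C A)
    (hD : IsPreconnected D) (hDA : D ⊆ A) (hCD : (C ∩ D).Nonempty) : D ⊆ C := by
  obtain ⟨x, -, rfl⟩ := h
  obtain ⟨y, hyC, hyD⟩ := hCD
  rw [connectedComponentIn_eq hyC]
  exact hD.subset_connectedComponentIn hyD hDA

theorem IsComponentOf.eq_of_inter_nonempty {C D A : Set M} (hC : IsComponentOf C A)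
    (hD : IsComponentOf D A) (h : (C ∩ D).Nonempty) : C = D :=
  (hD.subset_of_inter_nonempty hC.isPreconnected hC.subset (inter_comm C D ▸ h)).antisymm
    (hC.subset_of_inter_nonempty hD.isPreconnected hD.subset h)

theorem isComponentOf_of_forall {S A : Set M} (hS : IsPreconnected S) (hne : S.Nonempty)
    (hSA : S ⊆ A) (hmax : ∀ T ⊆ A, IsPreconnected T → (S ∩ T).Nonempty → T ⊆ S) :
    IsComponentOf S A := by
  obtain ⟨x, hx⟩ := hne
  exact ⟨x, hSA hx, (hS.subset_connectedComponentIn hx hSA).antisymm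
    (hmax _ (connectedComponentIn_subset _ _) isPreconnected_connectedComponentIn
      ⟨x, hx, mem_connectedComponentIn (hSA hx)⟩)⟩

/-- The components of an open subset of a locally connected space which all meet a given compact set
are finitely many. -/
theorem finite_setOf_isComponentOf [LocallyConnectedSpace M] {A Q : Set M} (hA : IsOpen A)
    (hQ : IsCompact Q) (hQA : Q ⊆ A) (hmeet : ∀ C, IsComponentOf C A → (C ∩ Q).Nonempty) :
    {C : Set M | IsComponentOf C A}.Finite := by
  obtain ⟨T, hT⟩ := hQ.elim_finite_subcover
    (fun x : A => connectedComponentIn A (x : M)) (fun _ => hA.connectedComponentIn)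
    fun x hx => mem_iUnion.2 ⟨⟨x, hQA hx⟩, mem_connectedComponentIn (hQA hx)⟩
  refine (T.finite_toSet.image fun x : A => connectedComponentIn A (x : M)).subset fun C hC => ?_
  obtain ⟨y, hyC, hyQ⟩ := hmeet C hC
  obtain ⟨x, hxT, hyx⟩ := mem_iUnion₂.1 (hT hyQ)
  exact ⟨x, hxT, IsComponentOf.eq_of_inter_nonempty ⟨x, x.2, rfl⟩ hC ⟨y, hyx, hyC⟩⟩

/-- A component of an open set meets each compact subset in a compact set. -/
theorem IsComponentOf.isCompact_inter [LocallyConnectedSpace M] {C A Q : Set M}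
    (hC : IsComponentOf C A) (hA : IsOpen A) (hQ : IsCompact Q) (hQA : Q ⊆ A) :
    IsCompact (Q ∩ C) := by
  -- The union of the other components is open, so removing it from `Q` leaves a compact set.
  let V : Set M := ⋃ x ∈ A \ C, connectedComponentIn A x
  have hV : IsOpen V := isOpen_biUnion fun _ _ => hA.connectedComponentIn
  have : Q ∩ C = Q \ V := by
    ext y
    refine and_congr_right fun hy => ⟨fun hyC hyV => ?_, fun hyV => ?_⟩
    · obtain ⟨x, hx, hyx⟩ := mem_iUnion₂.1 hyV
      have heq : C = connectedComponentIn A x :=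
        hC.eq_of_inter_nonempty ⟨x, hx.1, rfl⟩ ⟨y, hyC, hyx⟩
      exact hx.2 (heq ▸ mem_connectedComponentIn hx.1)
    · by_contra hyC
      exact hyV (mem_iUnion₂.2 ⟨y, ⟨hQA hy, hyC⟩, mem_connectedComponentIn (hQA hy)⟩)
  rw [this]
  exact hQ.diff hV

theorem IsComponentOf.isInvariant {φ : Flow ℝ M} {C A : Set M} (hC : IsComponentOf C A)
    (hA : IsInvariant φ A) : IsInvariant φ C := by
  intro t x hx
  refine hC.subset_of_inter_nonempty (D := range fun s : ℝ => φ s x)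
    (isPreconnected_range (by fun_prop)) ?_ ⟨x, hx, 0, φ.map_zero_apply x⟩ ⟨t, rfl⟩
  rintro _ ⟨s, rfl⟩
  exact hA s (hC.subset hx)

/-! ### Dissonance at the boundary of the stable set -/

/-- The positive prolongational limit set of a point in the closure of the stable set of a compact
set `K` meets `K`. -/
theorem posProlong_inter_nonempty [T2Space M] {φ : Flow ℝ M} {K : Set M} (hK : IsCompact K) {x : M}
    (hx : x ∈ closure (stableSet φ K)) : (posProlong φ x ∩ K).Nonempty := by
  let P : (𝓝 x).sets × Ioi (0 : ℝ) → Set M := fun i => K ∩ closure (image2 φ (Ici i.2.1) i.1.1)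
  have hcl : ∀ i, IsClosed (P i) := fun i => hK.isClosed.inter isClosed_closure
  have : Nonempty ((𝓝 x).sets × Ioi (0 : ℝ)) := ⟨⟨univ, univ_mem⟩, ⟨1, mem_Ioi.2 one_pos⟩⟩
  obtain ⟨y, hy⟩ := IsCompact.nonempty_iInter_of_directed_nonempty_isCompact_isClosed P
    (fun i j => ⟨⟨⟨i.1.1 ∩ j.1.1, inter_mem i.1.2 j.1.2⟩,
        ⟨max i.2.1 j.2.1, mem_Ioi.2 (lt_max_of_lt_left (mem_Ioi.1 i.2.2))⟩⟩,
      inter_subset_inter_right _ (closure_mono (image2_subset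
        (Ici_subset_Ici.2 (le_max_left _ _)) inter_subset_left)),
      inter_subset_inter_right _ (closure_mono (image2_subset
        (Ici_subset_Ici.2 (le_max_right _ _)) inter_subset_right))⟩)
    (fun i => by
      -- A stable point `z` in the neighborhood has a limit point in `K`, which lies in the closure
      -- of every tail of its orbit.
      obtain ⟨z, hzU, hzK⟩ := mem_closure_iff_nhds.1 hx _ i.1.2
      obtain ⟨⟨y, hy⟩, hsub⟩ := hzK
      exact ⟨y, hsub hy, closure_mono (image2_subset_left (singleton_subset_iff.2 hzU))
        (omegaLimit_subset_closure_image2 _ _ _ (Ici_mem_atTop i.2.1) hy)⟩)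
    (fun i => hK.of_isClosed_subset (hcl i) inter_subset_left) hcl
  rw [mem_iInter] at hy
  refine ⟨y, ?_, (hy ⟨⟨univ, univ_mem⟩, ⟨1, mem_Ioi.2 one_pos⟩⟩).1⟩
  simp only [posProlong, mem_iInter]
  exact fun U hU t ht => (hy ⟨⟨U, hU⟩, ⟨t, ht⟩⟩).2

/-- Relative boundary points of the stable set in `C` would be dissonant, so the open set is also
relatively closed in the connected set `C`. -/
theorem subset_stableSet_of_disjoint_posDissonant [T2Space M] {φ : Flow ℝ M} {K C : Set M}
    (hK : IsCompact K) (hA : IsOpen (stableSet φ K \ K)) (hC : IsPreconnected C)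
    (hCI : C ⊆ influence φ K \ K) (hdis : Disjoint C (posDissonant φ K))
    (hne : (C ∩ (stableSet φ K \ K)).Nonempty) : C ⊆ stableSet φ K \ K := by
  by_contra hsub
  obtain ⟨y, hyC, hyA⟩ := not_subset.1 hsub
  obtain ⟨z, hzC, hz⟩ : ∃ z ∈ C, z ∈ closure (stableSet φ K \ K) \ (stableSet φ K \ K) := by
    by_contra! hcon
    have hcover : C ⊆ (stableSet φ K \ K) ∪ (closure (stableSet φ K \ K))ᶜ := fun z hz => by
      by_contra hzn
      rw [mem_union, not_or, mem_compl_iff, not_not] at hzn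
      exact hcon z hz ⟨hzn.2, hzn.1⟩
    obtain ⟨z, -, hzA, hzn⟩ := hC _ _ hA isClosed_closure.isOpen_compl hcover hne
      ⟨y, hyC, (hcover hyC).resolve_left hyA⟩
    exact hzn (subset_closure hzA)
  exact disjoint_left.1 hdis hzC ⟨(hCI hzC).1, fun h => hz.2 ⟨h, (hCI hzC).2⟩,
    posProlong_inter_nonempty hK (closure_mono sdiff_subset hz.1)⟩

/-! ### Section and deformation retraction on a component -/

namespace IsCrossSection

variable {φ : Flow ℝ M} {A E C : Set M} {σ : M → ℝ}

theorem apply_flow (h : IsCrossSection φ A E σ) {x : M} (hx : x ∈ A) (t : ℝ) :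
    σ (φ t x) = σ x - t := by
  refine (h.unique _ (h.invariant t hx) _ ?_).symm
  rw [← φ.map_add, sub_add_cancel]
  exact h.flow_mem x hx

theorem apply_eq_zero (h : IsCrossSection φ A E σ) {x : M} (hx : x ∈ E) : σ x = 0 :=
  (h.unique x (h.subset hx) 0 (by rwa [φ.map_zero_apply])).symm

theorem isPreconnected_inter (h : IsCrossSection φ A E σ) (hC : IsPreconnected C)
    (hinv : IsInvariant φ C) (hCA : C ⊆ A) : IsPreconnected (E ∩ C) := by
  -- Flowing each point to `E` is a continuous map of `C` onto `E ∩ C`.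
  have : E ∩ C = (fun x => φ (σ x) x) '' C := by
    ext x
    constructor
    · rintro ⟨hxE, hxC⟩
      exact ⟨x, hxC, by simp [h.apply_eq_zero hxE]⟩
    · rintro ⟨y, hy, rfl⟩
      exact ⟨h.flow_mem y (hCA hy), hinv _ hy⟩
  rw [this]
  exact hC.image _ ((φ.continuous continuous_fst continuous_snd).comp_continuousOn
    ((h.continuousOn.mono hCA).prodMk continuousOn_id))

theorem isSection_restrict (h : IsCrossSection φ A E σ) (hinv : IsInvariant φ C) (hCA : C ⊆ A) :
    IsSection (φ.restrict hinv) (Subtype.val ⁻¹' (E ∩ C)) := by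
  have hσ : Continuous (fun x : C => σ x) :=
    continuousOn_iff_continuous_domRestrict.1 (h.continuousOn.mono hCA)
  refine isHomeomorph_iff_exists_inverse.2 ⟨?_, fun x =>
    (⟨φ.restrict hinv (σ x) x, h.flow_mem _ (hCA x.2), (φ.restrict hinv (σ x) x).2⟩, -σ x),
    ?_, ?_, ?_⟩
  · exact (φ.restrict hinv).continuous continuous_snd (continuous_subtype_val.comp continuous_fst)
  · rintro ⟨⟨x, hxE, -⟩, t⟩
    have hσt : σ (φ t x) = -t := by
      rw [h.apply_flow (h.subset hxE), h.apply_eq_zero hxE, zero_sub]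
    refine Prod.ext (Subtype.ext (Subtype.ext ?_)) ?_
    · show φ (σ (φ t x)) (φ t x) = x
      rw [hσt, ← φ.map_add, neg_add_cancel, φ.map_zero_apply]
    · show -σ (φ t x) = t
      rw [hσt, neg_neg]
  · intro x
    refine Subtype.ext ?_
    show φ (-σ x) (φ (σ x) x) = x
    rw [← φ.map_add, neg_add_cancel, φ.map_zero_apply]
  · exact (Continuous.subtype_mk ((φ.restrict hinv).continuous hσ continuous_id) _).prodMk hσ.neg

theorem isStrongDeformationRetraction (h : IsCrossSection φ A E σ) (hinv : IsInvariant φ C)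
    (hCA : C ⊆ A) : ∃ τ : C → ℝ, Continuous τ ∧
      IsStrongDeformationRetraction
        (fun (s : unitInterval) (x : C) => φ.restrict hinv ((s : ℝ) * τ x) x)
        (Subtype.val ⁻¹' (E ∩ C)) := by
  have hσ : Continuous (fun x : C => σ x) :=
    continuousOn_iff_continuous_domRestrict.1 (h.continuousOn.mono hCA)
  refine ⟨fun x => σ x, hσ, ?_, fun x => ?_, fun x => ?_, fun s x hx => ?_⟩
  · exact (φ.restrict hinv).continuous
      ((continuous_subtype_val.comp continuous_fst).mul (hσ.comp continuous_snd)) continuous_snd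
  · simp
  · refine ⟨?_, Subtype.coe_prop _⟩
    simpa using h.flow_mem x (hCA x.2)
  · simp [h.apply_eq_zero hx.1]

/-- A connected subset of `E ∪ F` meeting `E` stays in `E`, as `E` and `F` are disjoint and closed;
being connected inside `L`, it then stays in `C`. -/
theorem isComponentOf_inter [T2Space M] {F L Q : Set M} (h : IsCrossSection φ A E σ)
    (hF : IsCompact F) (hEF : Disjoint E F) (hAL : A ⊆ L) (hC : IsComponentOf C L)
    (hinv : IsInvariant φ C) (hCA : C ⊆ A) (hQ : Q ⊆ E ∪ F) (hQE : E ∩ C ⊆ Q) :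
    IsComponentOf (E ∩ C) Q := by
  refine isComponentOf_of_forall (h.isPreconnected_inter hC.isPreconnected hinv hCA) ?_ hQE ?_
  · obtain ⟨x, hx⟩ := hC.nonempty
    exact ⟨_, h.flow_mem x (hCA hx), hinv _ hx⟩
  · rintro T hTQ hT ⟨x, hx, hxT⟩
    have hTE : T ⊆ E := by
      intro y hy
      refine (hQ (hTQ hy)).resolve_right fun hyF => ?_
      obtain ⟨z, -, hzE, hzF⟩ := isPreconnected_closed_iff.1 hT E F h.isCompact.isClosed hF.isClosed
        (hTQ.trans hQ) ⟨x, hxT, hx.1⟩ ⟨y, hy, hyF⟩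
      exact disjoint_left.1 hEF hzE hzF
    exact subset_inter hTE (hC.subset_of_inter_nonempty hT
      (hTE.trans (h.subset.trans hAL)) ⟨x, hx.2, hxT⟩)

end IsCrossSection

/-! ### Parallelizable components have no dissonant points -/

/-- A section of a flow yields a continuous function which grows at unit speed along the orbits. -/
theorem IsSection.exists_time {X : Type u} [TopologicalSpace X] {φ : Flow ℝ X} {S : Set X}
    (h : IsSection φ S) : ∃ κ : X → ℝ, Continuous κ ∧ ∀ t x, κ (φ t x) = κ x + t := by
  obtain ⟨-, g, hl, hr, hg⟩ := isHomeomorph_iff_exists_inverse.1 h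
  refine ⟨fun x => (g x).2, continuous_snd.comp hg, fun t x => ?_⟩
  have hx : φ (g x).2 ((g x).1 : X) = x := hr x
  have := hl ((g x).1, (g x).2 + t)
  simp only [add_comm (g x).2 t, φ.map_add, hx] at this
  simp [this, add_comm]

theorem IsSection.reverse {X : Type u} [TopologicalSpace X] {φ : Flow ℝ X} {S : Set X}
    (h : IsSection φ S) : IsSection φ.reverse S :=
  IsHomeomorph.comp h ((Homeomorph.refl S).prodCongr (Homeomorph.neg ℝ)).isHomeomorph

theorem IsSplitBlock.disjoint_posDissonant_of_isParallelizable [T2Space M]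
    [LocallyConnectedSpace M] {φ : Flow ℝ M} {N K E F C : Set M} (h : IsSplitBlock φ N K E F)
    (hL : IsOpen (influence φ K \ K)) (hC : IsComponentOf C (influence φ K \ K))
    (hinv : IsInvariant φ C) (hpar : IsParallelizable (φ.restrict hinv)) :
    Disjoint C (posDissonant φ K) := by
  rw [disjoint_left]
  rintro x hxC ⟨-, hxA, y, hy, hyK⟩
  obtain ⟨S, hS⟩ := hpar
  obtain ⟨κ, hκ, hκt⟩ := hS.exists_time
  obtain ⟨σ, hσ⟩ := h.exists_isCrossSection
  have hCo : IsOpen C := hC.isOpen hL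
  have hcomp : IsCompact ((Subtype.val : C → M) ⁻¹' (E ∩ C)) := by
    rw [IsInducing.subtypeVal.isCompact_iff, Subtype.image_preimage_coe, inter_comm, inter_assoc,
      inter_self]
    exact hC.isCompact_inter hL h.entrance_isCompact
      (h.entrance_subset_stableSet_diff.trans (sdiff_subset_sdiff_left subset_union_left))
  obtain ⟨B, hB⟩ := (hcomp.image hκ).bddAbove
  -- If no such `T` existed, the orbit of `x` would eventually stay in `N`, making `x` stable.
  obtain ⟨T, hTpos, hTB, hTN⟩ : ∃ T : ℝ, 0 < T ∧ B - κ ⟨x, hxC⟩ + 1 < T ∧ φ T x ∉ N := by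
    by_contra! hcon
    refine hxA (h.mem_stableSet (t := max 1 (B - κ ⟨x, hxC⟩ + 2)) (mem_posPart_iff.2 fun t ht => ?_))
    rw [← φ.map_add]
    refine hcon _ ?_ ?_
    · linarith [le_max_left 1 (B - κ ⟨x, hxC⟩ + 2)]
    · linarith [le_max_right 1 (B - κ ⟨x, hxC⟩ + 2)]
  have hU1 : (fun u => φ T u) ⁻¹' Nᶜ ∈ 𝓝 x :=
    (h.isClosed.isOpen_compl.preimage (by fun_prop)).mem_nhds hTN
  have hU2 : Subtype.val '' {u : C | κ ⟨x, hxC⟩ - 1 < κ u} ∈ 𝓝 x :=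
    (hCo.isOpenMap_subtype_val _ (isOpen_lt continuous_const hκ)).mem_nhds
      ⟨⟨x, hxC⟩, sub_one_lt (κ ⟨x, hxC⟩), rfl⟩
  simp only [posProlong, mem_iInter] at hy
  obtain ⟨_, hint, t, ht, u, ⟨huN, u, hu, rfl⟩, rfl⟩ := mem_closure_iff.1
    (hy _ (inter_mem hU1 hU2) T hTpos) _ isOpen_interior (h.isolating.nhd hyK)
  -- The orbit of `u` is outside `N` at time `T` and back in its interior at `t ≥ T`. It is
  -- therefore in `N⁺` at time `t`, and its entrance time exceeds `T`.
  have hneg : φ t u ∉ negPart φ N := fun hneg => huN <| by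
    have := mem_negPart_iff.1 hneg (T - t) (by linarith [mem_Ici.1 ht])
    rwa [← φ.map_add, sub_add_cancel] at this
  have huA : (u : M) ∈ stableSet φ K \ K :=
    ⟨h.mem_stableSet (h.interior_diff_subset ⟨hint, hneg⟩), (hC.subset u.2).2⟩
  have hTσ : T < σ u := by
    by_contra! hle
    exact huN (IsSplitBlock.flow_mem_posPart
      (h.entrance_subset_posPart (hσ.flow_mem u huA)) hle).1
  have hbd : κ (φ.restrict hinv (σ u) u) ≤ B :=
    hB ⟨_, ⟨hσ.flow_mem u huA, Subtype.coe_prop _⟩, rfl⟩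
  -- At the entrance the clock reads `κ u + σ u > (κ x - 1) + T > B`, against its bound on `E ∩ C`.
  rw [hκt] at hbd
  have : κ ⟨x, hxC⟩ - 1 < κ u := hu
  linarith

theorem disjoint_extDissonant {φ : Flow ℝ M} {K C : Set M} (hC : C ⊆ influence φ K \ K) :
    Disjoint C (extDissonant φ K) :=
  disjoint_left.2 fun _ hx hd => hd.1 (hC hx).1

end NonSaddle

/-! ### The main theorem -/

open NonSaddle in
theorem mainTheorem10 {M : Type u} [TopologicalSpace M] [LocallyCompactSpace M]
    (hM : NonSaddle.IsANR M) (φ : Flow ℝ M) (K N : Set M)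
    (hK : NonSaddle.IsIsolatedInvariant φ K) (hKns : ¬ NonSaddle.IsSaddle φ K)
    (hN : NonSaddle.IsIsolatingBlock φ N K)
    (hNpm : N = NonSaddle.posPart φ N ∪ NonSaddle.negPart φ N)
    (hNI : N ⊆ NonSaddle.influence φ K) :
    {C : Set M | NonSaddle.IsComponentOf C (NonSaddle.influence φ K \ K)}.Finite ∧
    ∀ C : Set M, NonSaddle.IsComponentOf C (NonSaddle.influence φ K \ K) →
      ∃ hC : IsInvariant φ C,
        (Disjoint C (NonSaddle.dissonant φ K) ↔
          NonSaddle.IsParallelizable (φ.restrict hC)) ∧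
        (Disjoint C (NonSaddle.dissonant φ K) →
          ∃ S : Set M, NonSaddle.IsComponentOf S (frontier N) ∧
            NonSaddle.IsComponentOf S (frontier N ∩ C) ∧
            NonSaddle.IsSection (φ.restrict hC) (Subtype.val ⁻¹' S) ∧
            ∃ τ : C → ℝ, Continuous τ ∧
              NonSaddle.IsStrongDeformationRetraction
                (fun (s : unitInterval) (x : C) => φ.restrict hC ((s : ℝ) * τ x) x)
                (Subtype.val ⁻¹' S)) := by
  have := hM.1
  have := hM.locallyConnectedSpace
  obtain ⟨hNK, E, F, hE, hF, hfr, hent, hexit, -, -⟩ := hN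
  have hb : IsSplitBlock φ N K E F := ⟨hNK, hfr, hE, hF, hent, hexit, hNpm.subset⟩
  obtain ⟨σ, hσ⟩ := hb.exists_isCrossSection
  obtain ⟨ρ', hρ'⟩ := hb.reverse.exists_isCrossSection
  have hρ := hρ'.of_reverse
  rw [stableSet_reverse] at hρ
  have hLeq : influence φ K \ K = (stableSet φ K \ K) ∪ (unstableSet φ K \ K) := union_sdiff_distrib
  have hL : IsOpen (influence φ K \ K) := hLeq ▸ hσ.isOpen.union hρ.isOpen
  have hAL : stableSet φ K \ K ⊆ influence φ K \ K := sdiff_subset_sdiff_left subset_union_left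
  have hRL : unstableSet φ K \ K ⊆ influence φ K \ K := sdiff_subset_sdiff_left subset_union_right
  have hLinv : IsInvariant φ (influence φ K \ K) := by
    rw [hLeq]
    exact fun t x hx => hx.imp (fun h => hσ.invariant t h) (fun h => hρ.invariant t h)
  have hinv : ∀ C, IsComponentOf C (influence φ K \ K) → IsInvariant φ C := fun C hC =>
    hC.isInvariant hLinv
  have hsec : ∀ C (hC : IsComponentOf C (influence φ K \ K)), Disjoint C (dissonant φ K) →
      ∃ S : Set M, IsComponentOf S (frontier N) ∧ IsComponentOf S (frontier N ∩ C) ∧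
        IsSection (φ.restrict (hinv C hC)) (Subtype.val ⁻¹' S) ∧
        ∃ τ : C → ℝ, Continuous τ ∧ IsStrongDeformationRetraction
          (fun (s : unitInterval) (x : C) => φ.restrict (hinv C hC) ((s : ℝ) * τ x) x)
          (Subtype.val ⁻¹' S) := by
    intro C hC hdis
    rw [dissonant, disjoint_union_right, disjoint_union_right] at hdis
    obtain ⟨x, hx⟩ := hC.nonempty
    rcases (hLeq ▸ hC.subset hx : x ∈ (stableSet φ K \ K) ∪ (unstableSet φ K \ K)) with hxA | hxR
    · have hCA := subset_stableSet_of_disjoint_posDissonant hK.isCompact hσ.isOpen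
        hC.isPreconnected hC.subset hdis.1.1 ⟨x, hx, hxA⟩
      exact ⟨E ∩ C,
        hσ.isComponentOf_inter hF hb.disjoint_entrance_exit hAL hC (hinv C hC) hCA hfr.subset
          (fun y hy => hfr ▸ Or.inl hy.1),
        hσ.isComponentOf_inter hF hb.disjoint_entrance_exit hAL hC (hinv C hC) hCA
          (inter_subset_left.trans hfr.subset) (fun y hy => ⟨hfr ▸ Or.inl hy.1, hy.2⟩),
        hσ.isSection_restrict (hinv C hC) hCA,
        hσ.isStrongDeformationRetraction (hinv C hC) hCA⟩
    · have hCR : C ⊆ unstableSet φ K \ K := by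
        rw [← stableSet_reverse]
        refine subset_stableSet_of_disjoint_posDissonant hK.isCompact hρ'.isOpen
          hC.isPreconnected (by rw [influence_reverse]; exact hC.subset) ?_ ⟨x, hx, ?_⟩
        · rw [posDissonant_reverse]
          exact hdis.1.2
        · rwa [stableSet_reverse]
      have hfr' : frontier N = F ∪ E := by rw [hfr, union_comm]
      exact ⟨F ∩ C,
        hρ.isComponentOf_inter hE hb.disjoint_entrance_exit.symm hRL hC (hinv C hC) hCR hfr'.subset
          (fun y hy => hfr' ▸ Or.inl hy.1),
        hρ.isComponentOf_inter hE hb.disjoint_entrance_exit.symm hRL hC (hinv C hC) hCR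
          (inter_subset_left.trans hfr'.subset) (fun y hy => ⟨hfr' ▸ Or.inl hy.1, hy.2⟩),
        hρ.isSection_restrict (hinv C hC) hCR,
        hρ.isStrongDeformationRetraction (hinv C hC) hCR⟩
  refine ⟨finite_setOf_isComponentOf hL (hE.union hF)
    (union_subset (hσ.subset.trans hAL) (hρ.subset.trans hRL)) fun C hC => ?_,
    fun C hC => ⟨hinv C hC, ⟨fun hdis => ?_, fun hpar => ?_⟩, hsec C hC⟩⟩
  · obtain ⟨x, hx⟩ := hC.nonempty
    rcases (hLeq ▸ hC.subset hx : x ∈ (stableSet φ K \ K) ∪ (unstableSet φ K \ K)) with hxA | hxR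
    · exact ⟨_, hinv C hC _ hx, Or.inl (hσ.flow_mem x hxA)⟩
    · exact ⟨_, hinv C hC _ hx, Or.inr (hρ.flow_mem x hxR)⟩
  · obtain ⟨S, -, -, hS, -⟩ := hsec C hC hdis
    exact ⟨_, hS⟩
  · rw [dissonant, disjoint_union_right, disjoint_union_right]
    refine ⟨⟨hb.disjoint_posDissonant_of_isParallelizable hL hC (hinv C hC) hpar, ?_⟩,
      disjoint_extDissonant hC.subset⟩
    obtain ⟨S, hS⟩ := hpar
    -- Negative dissonance is positive dissonance of the reversed flow, which has the same section.
    rw [← influence_reverse] at hL hC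
    rw [← posDissonant_reverse]
    exact hb.reverse.disjoint_posDissonant_of_isParallelizable hL hC
      (isInvariant_reverse_iff.2 (hC.isInvariant (influence_reverse φ K ▸ hLinv))) ⟨S, hS.reverse⟩
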